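/- For a positive integer $n$, let $P_n(\mathbb{Z})\simeq\mathbb{Z}^{n+1}$ be the group of homogeneous polynomials of degree $n$ in two variables $X,Y$ with integer coefficients (including $0$), on which $GL_2(\mathbb{Z})$ acts by $$(\rho_n(A)P)(X,Y)=P((X,Y)\cdot A)=P(a_{11}X+a_{21}Y,\;a_{12}X+a_{22}Y),\qquad A=\begin{pmatrix}a_{11}&a_{12}\\a_{21}&a_{22}\end{pmatrix}.$$ Put $\eta(n)=1,-1,0$ according to whether $n\equiv 0,1,2 \pmod 3$. The rank $\mathrm{rk}$ of a finitely generated abelian group means its torsion-free rank. Theorem. Let $n\geq 2$ be even. Then the first group cohomology $H^1(GL_2(\mathbb{Z}),P_n(\mathbb{Z}))$ (1-cocycles modulo 1-coboundaries for the action $\rho_n$) is a finitely generated abelian group, and $$\mathrm{rk}\bigl(H^1(GL_2(\mathbb{Z}),P_n(\mathbb{Z}))\bigr)=\frac{n-5+3(-1)^{\frac n2+1}-4\eta(n)}{12}.$$ In particular, $\mathrm{rk}\bigl(H^1(GL_2(\mathbb{Z}),P_n(\mathbb{Z}))\bigr)\geq \frac{n-12}{12}$. -/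

import Mathlib

open MvPolynomial

/-- `P_n(ℤ)`: polynomials in two variables `X = X 0`, `Y = X 1` with integer coefficients which are
homogeneous of degree `n` (including `0`). -/
abbrev BinaryForm (n : ℕ) : Type :=
  MvPolynomial.homogeneousSubmodule (Fin 2) ℤ n

/-- The substitution `P(X, Y) ↦ P((X, Y) · A) = P(a₁₁ X + a₂₁ Y, a₁₂ X + a₂₂ Y)`. -/
noncomputable def binarySubst (A : Matrix (Fin 2) (Fin 2) ℤ) :
    MvPolynomial (Fin 2) ℤ →ₐ[ℤ] MvPolynomial (Fin 2) ℤ :=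
  aeval fun j => C (A 0 j) * X 0 + C (A 1 j) * X 1

theorem binarySubst_one : binarySubst 1 = AlgHom.id ℤ _ := by
  ext j : 1
  fin_cases j <;> simp [binarySubst]

theorem binarySubst_mul (A B : Matrix (Fin 2) (Fin 2) ℤ) :
    binarySubst (A * B) = (binarySubst A).comp (binarySubst B) := by
  ext j : 1
  simp only [binarySubst, AlgHom.comp_apply, aeval_X, map_add, map_mul, Matrix.mul_apply,
    Fin.sum_univ_two, algHom_C, algebraMap_eq]
  ring

theorem binarySubst_isHomogeneous (A : Matrix (Fin 2) (Fin 2) ℤ) {n : ℕ}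
    {P : MvPolynomial (Fin 2) ℤ} (hP : P.IsHomogeneous n) :
    (binarySubst A P).IsHomogeneous n := by
  have h := hP.aeval (fun j : Fin 2 => (C (A 0 j) * X 0 + C (A 1 j) * X 1 : MvPolynomial (Fin 2) ℤ))
    (n := 1) (fun j => ((isHomogeneous_X ℤ 0).C_mul _).add ((isHomogeneous_X ℤ 1).C_mul _))
  simpa [binarySubst] using h

/-- The representation `ρ_n` of `GL₂(ℤ)` on `P_n(ℤ)`, `(ρ_n(A) P)(X, Y) = P((X, Y) · A)`. -/
noncomputable def binaryFormRep (n : ℕ) :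
    Representation ℤ (Matrix.GeneralLinearGroup (Fin 2) ℤ) (BinaryForm n) where
  toFun A := (binarySubst A.val).toLinearMap.restrict
    fun _ hP => binarySubst_isHomogeneous A.val hP
  map_one' := by
    ext P : 2
    simp [binarySubst_one]
  map_mul' A B := by
    ext P : 2
    simp only [Units.val_mul, binarySubst_mul]
    rfl

/-- `H¹(GL₂(ℤ), P_n(ℤ))`, the first group cohomology (1-cocycles modulo 1-coboundaries). -/
noncomputable abbrev H1GL2 (n : ℕ) : ModuleCat ℤ :=
  groupCohomology.H1 (Rep.of (binaryFormRep n))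

/-- `η(n) = 1, -1, 0` according to whether `n ≡ 0, 1, 2 (mod 3)`. -/
def eta (n : ℕ) : ℤ :=
  if n % 3 = 0 then 1 else if n % 3 = 1 then -1 else 0

/-!
The group `GL₂(ℤ)` is the amalgam of the dihedral groups `A` of order `8` (`squareGroup`, the
automorphisms of the square lattice) and `B` of order `12` (`hexagonGroup`, those of the hexagonal
lattice) over their intersection `C = {±1, ±swapGL}` of order `4`. Rationally finite groups have no
higher cohomology, so the Mayer-Vietoris sequence gives, with `V = P_n(ℤ)`,
`rk H¹ = rk V^C - rk V^A - rk V^B + rk V^G`.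

The amalgam structure itself is not needed. The map from `V^C` to `H¹` is written down directly:
if `χ : G → ℤ` is almost invariant, i.e. changes at only finitely many points under each right
translation, then `φ_m(g) = ∑ k, (χ(k g) - χ(k)) k⁻¹ m` is a cocycle (`almostInvariantCocycle`).
The function `acute`, which describes one side of an edge of the tree in the upper half-plane on
which `GL₂(ℤ)` acts, yields cocycles which vanish on `A` and are `b ↦ 4 (m - b m)` on `B` for
`m ∈ V^C`. As `A` and `B` are finite and generate the group, this map `V^C → H¹` has torsion
cokernel, and its kernel is commensurable with `V^A + V^B` (`finrank_H1_add_finrank_fixedBy`).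

For `n ≥ 1` no nonzero form is invariant under `GL₂(ℤ)` (`fixedBy_top`). The ranks of `V^A`, `V^B`,
`V^C` are means of traces (`sum_trace_eq_card_mul_finrank`). For even `n` the traces are `n + 1` for
`±1`, `1` for the reflections, `(-1)^(n/2)` for the rotations of order `4`, and `η(n)` for those of
order `3` and `6`; the last is an alternating sum of binomial coefficients along a diagonal of
Pascal's triangle (`sum_neg_one_pow_mul_choose`).
-/

/-! ### Ranks of submodules -/

open Module in
theorem Submodule.finrank_eq_of_forall_smul_mem {R M : Type*} [CommRing R] [IsDomain R]
    [AddCommGroup M] [Module R M] [Module.Finite R M] (p : Submodule R M)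
    (h : ∀ x : M, ∃ N : R, N ≠ 0 ∧ N • x ∈ p) : finrank R p = finrank R M := by
  have h1 := p.finrank_quotient_add_finrank
  have h0 : finrank R (M ⧸ p) = 0 := by
    rw [Module.finrank_eq_zero_iff_isTorsion]
    intro x
    obtain ⟨x, rfl⟩ := p.mkQ_surjective x
    obtain ⟨N, hN, hx⟩ := h x
    refine ⟨⟨N, mem_nonZeroDivisors_of_ne_zero hN⟩, ?_⟩
    change N • p.mkQ x = 0
    rw [← map_smul, Submodule.mkQ_apply, Submodule.Quotient.mk_eq_zero]
    exact hx
  omega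

open Module in
theorem Submodule.finrank_eq_of_le_of_forall_smul_mem {R M : Type*} [CommRing R] [IsDomain R]
    [IsNoetherianRing R] [AddCommGroup M] [Module R M] [Module.Finite R M]
    {p q : Submodule R M} (hpq : p ≤ q)
    (h : ∀ x ∈ q, ∃ N : R, N ≠ 0 ∧ N • x ∈ p) : finrank R p = finrank R q := by
  rw [← (Submodule.comapSubtypeEquivOfLe hpq).finrank_eq]
  exact Submodule.finrank_eq_of_forall_smul_mem _ fun x => h x x.2

open Module in
theorem Submodule.finrank_sup_add_finrank_inf {R M : Type*} [CommRing R] [IsDomain R]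
    [IsNoetherianRing R] [AddCommGroup M] [Module R M] [Module.Finite R M] (p q : Submodule R M) :
    finrank R (p ⊔ q : Submodule R M) + finrank R (p ⊓ q : Submodule R M) =
      finrank R p + finrank R q := by
  have h := Submodule.rank_sup_add_rank_inf_eq p q
  simp only [← finrank_eq_rank] at h
  exact_mod_cast h

/-! ### First cohomology of a group generated by two finite subgroups -/

namespace Representation

variable {k G V : Type} [CommRing k] [Group G] [AddCommGroup V] [Module k V]
  (ρ : Representation k G V)

/-- The vectors fixed by a subgroup `H`. -/
noncomputable abbrev fixedBy (H : Subgroup G) : Submodule k V := invariants (ρ.comp H.subtype)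

variable {ρ}

theorem mem_fixedBy {H : Subgroup G} {v : V} : v ∈ ρ.fixedBy H ↔ ∀ g ∈ H, ρ g v = v :=
  ⟨fun h g hg => h ⟨g, hg⟩, fun h g => h g g.2⟩

end Representation

namespace groupCohomology

open Representation Module

variable {k G V : Type} [CommRing k] [Group G] [AddCommGroup V] [Module k V]
  {ρ : Representation k G V}

theorem cocycles₁_map_mul (f : cocycles₁ (Rep.of ρ)) (g h : G) : f (g * h) = ρ g (f h) + f g :=
  (mem_cocycles₁_iff f.1).1 f.2 g h

theorem cocycles₁_eq_of_mem_closure {S : Set G} {f f' : cocycles₁ (Rep.of ρ)}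
    (h : ∀ g ∈ S, f g = f' g) {g : G} (hg : g ∈ Subgroup.closure S) : f g = f' g := by
  induction hg using Subgroup.closure_induction with
  | mem g hg => exact h g hg
  | one => simp
  | mul a b _ _ ha hb => rw [cocycles₁_map_mul, cocycles₁_map_mul, ha, hb]
  | inv a _ ha =>
    have key : ∀ u : cocycles₁ (Rep.of ρ), u a⁻¹ = -ρ a⁻¹ (u a) := fun u => by
      have h1 := cocycles₁_map_mul u a⁻¹ a
      rw [inv_mul_cancel, cocycles₁_map_one] at h1
      exact (neg_eq_of_add_eq_zero_right h1.symm).symm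
    rw [key, key, ha]

theorem cocycles₁_ext_of_closure {S : Set G} (hS : Subgroup.closure S = ⊤)
    {f f' : cocycles₁ (Rep.of ρ)} (h : ∀ g ∈ S, f g = f' g) : f = f' :=
  cocycles₁_ext fun g => cocycles₁_eq_of_mem_closure h (hS ▸ Subgroup.mem_top g)

theorem H1π_surjective : Function.Surjective (H1π (Rep.of ρ)).hom :=
  (ModuleCat.epi_iff_surjective _).1 inferInstance

/-- A cocycle is determined by its values on generators. -/
theorem finite_H1_of_closure [IsNoetherianRing k] [Module.Finite k V] {S : Set G} (hfin : S.Finite)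
    (hS : Subgroup.closure S = ⊤) : Module.Finite k (H1 (Rep.of ρ)) := by
  have : Finite S := hfin
  let r : cocycles₁ (Rep.of ρ) →ₗ[k] (S → V) :=
    { toFun := fun f s => f s
      map_add' := fun _ _ => rfl
      map_smul' := fun _ _ => rfl }
  have hr : Function.Injective r := fun f f' h =>
    cocycles₁_ext_of_closure hS fun g hg => congrFun h ⟨g, hg⟩
  have : Module.Finite k (cocycles₁ (Rep.of ρ)) := Module.Finite.of_injective r hr
  exact Module.Finite.of_surjective (H1π (Rep.of ρ)).hom H1π_surjective

/-- The principal cocycle `g ↦ ρ g v - v`. -/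
noncomputable def principalCocycle (ρ : Representation k G V) (v : V) : cocycles₁ (Rep.of ρ) :=
  ⟨fun g => ρ g v - v, d₀₁_apply_mem_cocycles₁ (A := Rep.of ρ) v⟩

@[simp] theorem principalCocycle_apply (v : V) (g : G) :
    principalCocycle ρ v g = ρ g v - v := rfl

theorem H1π_eq_zero_iff_exists (f : cocycles₁ (Rep.of ρ)) :
    (H1π (Rep.of ρ)).hom f = 0 ↔ ∃ v : V, f = principalCocycle ρ v := by
  refine (H1π_eq_zero_iff f).trans ⟨?_, ?_⟩
  · rintro ⟨v, hv⟩
    exact ⟨v, cocycles₁_ext fun g => (congrFun hv g).symm⟩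
  · rintro ⟨v, rfl⟩
    exact ⟨v, rfl⟩

/-- A finite subgroup `H` has cohomology killed by its order: sum the cocycle over `H`. -/
theorem exists_card_smul_eq (H : Subgroup G) [Finite H] (f : cocycles₁ (Rep.of ρ)) :
    ∃ v : V, ∀ g ∈ H, (Nat.card H : k) • f g = ρ g v - v := by
  have := Fintype.ofFinite H
  refine ⟨-∑ h : H, f h, fun g hg => ?_⟩
  have h1 : ∑ h : H, f (g * h) = ∑ h : H, f h :=
    Fintype.sum_equiv (Equiv.mulLeft (⟨g, hg⟩ : H)) _ _ fun _ => rfl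
  simp only [cocycles₁_map_mul, Finset.sum_add_distrib, Finset.sum_const, Finset.card_univ] at h1
  rw [map_neg, map_sum, ← h1, Nat.card_eq_fintype_card, Nat.cast_smul_eq_nsmul]
  abel

/-- If `G` is generated by finite subgroups `A` and `B`, and every `A ⊓ B`-invariant vector `m`
gives a cocycle `Φ m` vanishing on `A` and equal to `b ↦ N • (m - ρ b m)` on `B`, then the
Mayer-Vietoris rank formula of the amalgam of `A` and `B` over `A ⊓ B` holds: up to torsion, `Φ`
identifies `V^(A ⊓ B) / (V^A + V^B)` with the first cohomology. -/
theorem finrank_H1_add_finrank_fixedBy [IsDomain k] [CharZero k]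
    [IsNoetherianRing k] [Module.Finite k V] (A B : Subgroup G) [Finite A]
    [Finite B] (hAB : Subgroup.closure (A ∪ B : Set G) = ⊤) {N : k} (hN : N ≠ 0)
    (Φ : V →ₗ[k] cocycles₁ (Rep.of ρ)) (hΦA : ∀ m, ∀ a ∈ A, Φ m a = 0)
    (hΦB : ∀ m ∈ ρ.fixedBy (A ⊓ B), ∀ b ∈ B, Φ m b = N • (m - ρ b m)) :
    finrank k (H1 (Rep.of ρ)) + finrank k (ρ.fixedBy A) + finrank k (ρ.fixedBy B) =
      finrank k (ρ.fixedBy (A ⊓ B)) + finrank k (ρ.fixedBy ⊤) := by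
  have hfin : Module.Finite k (H1 (Rep.of ρ)) :=
    finite_H1_of_closure ((Set.toFinite (A : Set G)).union (Set.toFinite (B : Set G))) hAB
  have hmono : ∀ {H K : Subgroup G}, H ≤ K → ρ.fixedBy K ≤ ρ.fixedBy H := fun h v hv =>
    mem_fixedBy.2 fun g hg => mem_fixedBy.1 hv g (h hg)
  let Ψ : ρ.fixedBy (A ⊓ B) →ₗ[k] H1 (Rep.of ρ) :=
    (H1π (Rep.of ρ)).hom ∘ₗ Φ ∘ₗ (ρ.fixedBy (A ⊓ B)).subtype
  have hext : ∀ {f f' : cocycles₁ (Rep.of ρ)}, (∀ a ∈ A, f a = f' a) → (∀ b ∈ B, f b = f' b) →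
      f = f' := fun ha hb =>
    cocycles₁_ext_of_closure hAB fun g hg => hg.elim (ha g) (hb g)
  -- `Ψ` has torsion cokernel: a multiple of any cocycle becomes principal on `A`, and a further
  -- multiple of the difference is principal on `B`.
  have hrange : finrank k (LinearMap.range Ψ) = finrank k (H1 (Rep.of ρ)) := by
    refine Submodule.finrank_eq_of_forall_smul_mem _ fun x => ?_
    obtain ⟨f, rfl⟩ := H1π_surjective x
    obtain ⟨v, hv⟩ := exists_card_smul_eq A f
    set f' := (Nat.card A : k) • f - principalCocycle ρ v with hf'
    have hf'A : ∀ a ∈ A, f' a = 0 := fun a ha => sub_eq_zero.2 (hv a ha)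
    obtain ⟨m, hm⟩ := exists_card_smul_eq B f'
    have hmem : -m ∈ ρ.fixedBy (A ⊓ B) := by
      refine neg_mem (mem_fixedBy.2 fun g hg => ?_)
      rw [← sub_eq_zero, ← hm g hg.2, hf'A g hg.1, smul_zero]
    have heq : Φ (-m) = (N * Nat.card B) • f' := by
      refine hext (fun a ha => ?_) (fun b hb => ?_)
      · change _ = (N * Nat.card B) • f' a
        rw [hΦA _ a ha, hf'A a ha, smul_zero]
      · change _ = (N * Nat.card B) • f' b
        rw [hΦB _ hmem b hb, mul_smul, hm b hb, map_neg]
        abel_nf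
    refine ⟨N * Nat.card B * Nat.card A, mul_ne_zero (mul_ne_zero hN ?_) ?_, ⟨-m, hmem⟩, ?_⟩
    · exact_mod_cast Nat.card_pos.ne'
    · exact_mod_cast Nat.card_pos.ne'
    · change (H1π (Rep.of ρ)).hom (Φ (-m)) = _
      have h0 : (H1π (Rep.of ρ)).hom (principalCocycle ρ v) = 0 :=
        (H1π_eq_zero_iff_exists _).2 ⟨v, rfl⟩
      rw [heq, hf', map_smul, map_sub, h0, sub_zero, map_smul, smul_smul]
  -- The kernel of `Ψ` contains `V^A + V^B`, and is carried into it by `N`.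
  have hker : finrank k (LinearMap.ker Ψ) =
      finrank k (ρ.fixedBy A ⊔ ρ.fixedBy B : Submodule k V) := by
    rw [← Submodule.finrank_map_subtype_eq]
    symm
    refine Submodule.finrank_eq_of_le_of_forall_smul_mem (sup_le ?_ ?_) ?_
    · intro m hm
      have hmC := hmono (inf_le_left : A ⊓ B ≤ A) hm
      refine ⟨⟨m, hmC⟩, (H1π_eq_zero_iff_exists _).2 ⟨-(N • m), hext (fun a ha => ?_)
        fun b hb => ?_⟩, rfl⟩
      · change Φ m a = _
        rw [hΦA m a ha, principalCocycle_apply, map_neg, map_smul, mem_fixedBy.1 hm a ha, sub_self]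
      · change Φ m b = _
        rw [hΦB m hmC b hb, principalCocycle_apply, map_neg, map_smul, smul_sub]
        abel
    · intro m hm
      have hmC := hmono (inf_le_right : A ⊓ B ≤ B) hm
      refine ⟨⟨m, hmC⟩, (H1π_eq_zero_iff_exists _).2 ⟨0, hext (fun a ha => ?_)
        fun b hb => ?_⟩, rfl⟩
      · change Φ m a = _
        rw [hΦA m a ha, principalCocycle_apply, map_zero, sub_zero]
      · change Φ m b = _
        rw [hΦB m hmC b hb, principalCocycle_apply, map_zero, sub_zero, mem_fixedBy.1 hm b hb,
          sub_self, smul_zero]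
    · rintro _ ⟨⟨m, hmC⟩, hm, rfl⟩
      obtain ⟨v, hv⟩ := (H1π_eq_zero_iff_exists _).1 hm
      have hv' : ∀ g, Φ m g = ρ g v - v := fun g =>
        congrArg (fun f : cocycles₁ (Rep.of ρ) => f g) hv
      refine ⟨N, hN, Submodule.mem_sup.2 ⟨-v, neg_mem (mem_fixedBy.2 fun a ha => ?_), N • m + v,
        mem_fixedBy.2 fun b hb => ?_, ?_⟩⟩
      · rw [← sub_eq_zero, ← hv', hΦA m a ha]
      · have h1 := hv' b
        rw [hΦB m hmC b hb, smul_sub, sub_eq_sub_iff_add_eq_add] at h1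
        rw [map_add, map_smul, h1, add_comm]
      · simp
  -- A vector is fixed by `H` if and only if its principal cocycle vanishes on `H`.
  have hinf : (ρ.fixedBy A ⊓ ρ.fixedBy B : Submodule k V) = ρ.fixedBy ⊤ := by
    refine le_antisymm (fun v hv => mem_fixedBy.2 fun g _ => ?_)
      (le_inf (hmono le_top) (hmono le_top))
    have h0 : (0 : cocycles₁ (Rep.of ρ)) = principalCocycle ρ v :=
      hext (fun a ha => (sub_eq_zero.2 (mem_fixedBy.1 hv.1 a ha)).symm)
        fun b hb => (sub_eq_zero.2 (mem_fixedBy.1 hv.2 b hb)).symm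
    exact sub_eq_zero.1 (congrArg (fun f : cocycles₁ (Rep.of ρ) => f g) h0).symm
  have h1 := Ψ.quotKerEquivRange.finrank_eq
  have h2 := (LinearMap.ker Ψ).finrank_quotient_add_finrank
  have h3 := Submodule.finrank_sup_add_finrank_inf (ρ.fixedBy A) (ρ.fixedBy B)
  rw [hinf] at h3
  omega

end groupCohomology

/-! ### Ranks of invariants from traces -/

/-- Averaging over a finite group: the rank of the invariants is the mean of the traces. -/
theorem Representation.sum_trace_eq_card_mul_finrank {k G V : Type} [CommRing k] [IsDomain k]
    [IsPrincipalIdealRing k] [Group G] [AddCommGroup V] [Module k V]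
    [Module.Finite k V] [Module.Free k V] (ρ : Representation k G V) (H : Subgroup G) [Fintype H] :
    ∑ h : H, LinearMap.trace k V (ρ h) =
      (Fintype.card H : k) * Module.finrank k (ρ.fixedBy H) := by
  let p : V →ₗ[k] ρ.fixedBy H := (∑ h : H, ρ h).codRestrict _ fun v => by
    refine mem_fixedBy.2 fun g hg => ?_
    simp only [LinearMap.sum_apply, map_sum, ← Module.End.mul_apply, ← map_mul]
    exact Fintype.sum_equiv (Equiv.mulLeft (⟨g, hg⟩ : H)) _ _ fun _ => rfl
  -- `p` is the sum over `H`, with values in the invariants; on the invariants it is multiplication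
  -- by the order of `H`, and the trace does not see the order of the two compositions.
  have h1 : (ρ.fixedBy H).subtype ∘ₗ p = ∑ h : H, ρ h := rfl
  have h2 : p ∘ₗ (ρ.fixedBy H).subtype = (Fintype.card H : k) • LinearMap.id := by
    ext v
    have h3 : ∀ h : H, ρ h v = v := fun h => mem_fixedBy.1 v.2 h h.2
    simp [p, h3, Nat.cast_smul_eq_nsmul]
  have h4 := LinearMap.trace_comp_comm' (ρ.fixedBy H).subtype p
  rw [h1, h2, map_sum, map_smul, LinearMap.trace_id] at h4
  simpa using h4.symm

/-! ### Cocycles from almost invariant functions -/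

namespace groupCohomology

open Representation Module

variable {𝕜 G V : Type} [CommRing 𝕜] [Group G] [AddCommGroup V] [Module 𝕜 V]
  {ρ : Representation 𝕜 G V}

/-- A function on a group is almost invariant if each right translation changes only finitely many
of its values. -/
def AlmostInvariant {R : Type*} (χ : G → R) : Prop :=
  ∀ g, {k | χ (k * g) ≠ χ k}.Finite

theorem AlmostInvariant.of_closure {R : Type*} {χ : G → R} {S : Set G} (hS : Subgroup.closure S = ⊤)
    (h : ∀ g ∈ S, {k | χ (k * g) ≠ χ k}.Finite) : AlmostInvariant χ := by
  intro g
  have hg : g ∈ Subgroup.closure S := hS ▸ Subgroup.mem_top g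
  induction hg using Subgroup.closure_induction with
  | mem g hg => exact h g hg
  | one => simp
  | mul a b _ _ ha hb =>
    refine (ha.union (hb.preimage (mul_left_injective a).injOn)).subset fun k hk => ?_
    by_contra hcon
    simp only [Set.mem_union, Set.mem_ofPred_eq, Set.mem_preimage, not_or, not_not] at hcon hk
    exact hk (by rw [← mul_assoc, hcon.2, hcon.1])
  | inv a _ ha =>
    refine (ha.preimage (mul_left_injective a⁻¹).injOn).subset fun k hk => ?_
    simp only [Set.mem_ofPred_eq, Set.mem_preimage, inv_mul_cancel_right] at hk ⊢
    exact hk.symm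

/-- The cocycle `g ↦ ∑ k, (χ (k * g) - χ k) • ρ k⁻¹ m` attached to an almost invariant function `χ`
and a vector `m`. -/
noncomputable def almostInvariantCocycle (ρ : Representation 𝕜 G V) {χ : G → 𝕜}
    (hχ : AlmostInvariant χ) : V →ₗ[𝕜] cocycles₁ (Rep.of ρ) :=
  have key : ∀ m g, ∑ k ∈ (hχ g).toFinset, (χ (k * g) - χ k) • ρ k⁻¹ m =
      ∑ᶠ k, (χ (k * g) - χ k) • ρ k⁻¹ m := fun m g => by
    refine (finsum_eq_sum_of_support_subset _ fun k hk => ?_).symm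
    simp only [Set.Finite.coe_toFinset, Set.mem_ofPred_eq]
    intro h
    simp [h] at hk
  { toFun := fun m => ⟨fun g => ∑ k ∈ (hχ g).toFinset, (χ (k * g) - χ k) • ρ k⁻¹ m, by
      rw [mem_cocycles₁_iff]
      intro g h
      simp only [key]
      have hsupp : ∀ u g : G, (Function.support fun k =>
          (χ (k * u * g) - χ (k * u)) • ρ k⁻¹ m).Finite := fun u g => by
        refine ((hχ g).preimage (mul_left_injective u).injOn).subset fun k hk => ?_
        simp only [Set.mem_preimage, Set.mem_ofPred_eq]
        intro h
        simp [h] at hk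
      have h1 : (fun k => (χ (k * (g * h)) - χ k) • ρ k⁻¹ m) = fun k =>
          (χ (k * g * h) - χ (k * g)) • ρ k⁻¹ m + (χ (k * 1 * g) - χ (k * 1)) • ρ k⁻¹ m := by
        funext k
        rw [← add_smul, mul_assoc, mul_one, sub_add_sub_cancel]
      rw [h1, finsum_add_distrib (hsupp g h) (hsupp 1 g)]
      simp only [mul_one]
      congr 1
      have h2 := hsupp 1 h
      simp only [mul_one] at h2
      change _ = (ρ g).toAddMonoidHom _
      rw [AddMonoidHom.map_finsum _ h2]
      refine finsum_eq_of_bijective (· * g) (Group.mulRight_bijective g) fun k => ?_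
      simp [← Module.End.mul_apply, ← map_mul]⟩
    map_add' := fun m m' => Subtype.ext <| funext fun g => by
      simp [Finset.sum_add_distrib]
    map_smul' := fun c m => Subtype.ext <| funext fun g => by
      simp only [Finset.smul_sum, map_smul, smul_comm _ c, SetLike.val_smul, Pi.smul_apply,
        RingHom.id_apply] }

theorem almostInvariantCocycle_apply {χ : G → 𝕜} (hχ : AlmostInvariant χ) (m : V) (g : G) :
    almostInvariantCocycle ρ hχ m g = ∑ᶠ k, (χ (k * g) - χ k) • ρ k⁻¹ m := by
  refine (finsum_eq_sum_of_support_subset _ fun k hk => ?_).symm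
  simp only [Set.Finite.coe_toFinset, Set.mem_ofPred_eq]
  intro h
  simp [h] at hk

/-- If right translation by `u` changes `χ` by the difference of the indicators of a finite subgroup
`C` and of `C * u⁻¹`, the cocycle at `u` is a multiple of the principal one. -/
theorem almostInvariantCocycle_apply_eq_smul {χ : G → 𝕜} (hχ : AlmostInvariant χ) (C : Subgroup G)
    [Finite C] [DecidablePred (· ∈ C)] {u : G}
    (hu : ∀ k, χ (k * u) - χ k = (if k ∈ C then 1 else 0) - if k * u ∈ C then 1 else 0) {m : V}
    (hm : m ∈ ρ.fixedBy C) :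
    almostInvariantCocycle ρ hχ m u = (Nat.card C : 𝕜) • (m - ρ u m) := by
  have hsum : ∀ v : V, (Function.support fun k => if k ∈ C then v else 0).Finite ∧
      ∑ᶠ k, (if k ∈ C then v else 0) = (Nat.card C : 𝕜) • v := fun v => by
    have hsub : (Function.support fun k => if k ∈ C then v else 0) ⊆ (C : Set G) := fun k hk => by
      by_contra h
      exact hk (if_neg h)
    refine ⟨(Set.toFinite (C : Set G)).subset hsub, ?_⟩
    have := Fintype.ofFinite C
    rw [finsum_eq_sum_of_support_subset (s := (C : Set G).toFinite.toFinset) _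
        (by simpa using hsub),
      Finset.sum_congr rfl fun k hk => if_pos (by simpa using hk), Finset.sum_const,
      ← Set.ncard_eq_toFinset_card _ (C : Set G).toFinite, Nat.cast_smul_eq_nsmul]
    rfl
  have h1 : ∀ k, (χ (k * u) - χ k) • ρ k⁻¹ m =
      (if k ∈ C then m else 0) - if k * u ∈ C then ρ u m else 0 := fun k => by
    have ha : ∀ k ∈ C, ρ k⁻¹ m = m := fun k hk => mem_fixedBy.1 hm _ (inv_mem hk)
    rw [hu, sub_smul, ite_smul, ite_smul, one_smul, zero_smul]
    congr 1
    · split_ifs with h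
      · exact ha k h
      · rfl
    · -- `k⁻¹ = u * (k * u)⁻¹`, and `(k * u)⁻¹` fixes `m`.
      split_ifs with h
      · conv_rhs => rw [← ha _ h]
        rw [← Module.End.mul_apply, ← map_mul]
        simp
      · rfl
  rw [almostInvariantCocycle_apply, finsum_congr h1, finsum_sub_distrib (hsum m).1, (hsum m).2,
    smul_sub]
  · congr 1
    rw [← (hsum (ρ u m)).2]
    exact finsum_eq_of_bijective (· * u) (Group.mulRight_bijective u) fun k => rfl
  · exact (hsum (ρ u m)).1.preimage (mul_left_injective u).injOn

end groupCohomology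

/-! ### Two finite subgroups of `GL₂(ℤ)` and a half-tree -/

namespace BinaryGL

open Matrix

local notation "Γ" => GeneralLinearGroup (Fin 2) ℤ

/-- The subgroup of `GL₂(ℤ)` fixing the binary quadratic form with Gram matrix `M`. -/
def formStabilizer (M : Matrix (Fin 2) (Fin 2) ℤ) : Subgroup Γ where
  carrier := {g | g.val * M * g.valᵀ = M}
  one_mem' := by simp
  mul_mem' {a b} ha hb := by
    simp only [Set.mem_ofPred_eq, Units.val_mul, transpose_mul] at *
    calc _ = a.val * (b.val * M * b.valᵀ) * a.valᵀ := by simp only [Matrix.mul_assoc]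
      _ = M := by rw [hb, ha]
  inv_mem' {a} ha := by
    simp only [Set.mem_ofPred_eq] at *
    have h1 : (a⁻¹).val * a.val = 1 := by rw [← Units.val_mul]; simp
    calc _ = (a⁻¹).val * (a.val * M * a.valᵀ) * (a⁻¹).valᵀ := by rw [ha]
      _ = ((a⁻¹).val * a.val) * M * ((a⁻¹).val * a.val)ᵀ := by
        simp only [transpose_mul, Matrix.mul_assoc]
      _ = M := by rw [h1]; simp

/-- The stabilizer of `x² + y²`, a dihedral group of order `8`. -/
abbrev squareGroup : Subgroup Γ := formStabilizer 1

/-- The stabilizer of `2x² + 2xy + 2y²`, a dihedral group of order `12`. -/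
abbrev hexagonGroup : Subgroup Γ := formStabilizer !![2, 1; 1, 2]

/-- The swap of the coordinates. -/
def swapGL : Γ := ⟨!![0, 1; 1, 0], !![0, 1; 1, 0], by decide, by decide⟩

/-- The reflection `diag(1, -1)`. -/
def flipGL : Γ := ⟨!![1, 0; 0, -1], !![1, 0; 0, -1], by decide, by decide⟩

/-- A rotation of order `6` of the hexagonal lattice; it generates `hexagonGroup` together with
`swapGL`. -/
def rotGL : Γ := ⟨!![1, -1; 1, 0], !![0, 1; -1, 1], by decide, by decide⟩

theorem ext_iff_entries {g h : Γ} : g = h ↔ g.val 0 0 = h.val 0 0 ∧ g.val 0 1 = h.val 0 1 ∧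
    g.val 1 0 = h.val 1 0 ∧ g.val 1 1 = h.val 1 1 := by
  rw [Units.ext_iff, ← Matrix.ext_iff]
  simp [Fin.forall_fin_two, and_assoc]

theorem sq_det_eq_one (g : Γ) : (g.val 0 0 * g.val 1 1 - g.val 0 1 * g.val 1 0) ^ 2 = 1 := by
  have h := Int.isUnit_iff.1 ((Matrix.isUnit_iff_isUnit_det _).1 g.isUnit)
  rw [det_fin_two] at h
  rcases h with h | h <;> rw [h] <;> norm_num

theorem mem_squareGroup_iff {g : Γ} : g ∈ squareGroup ↔
    g.val 0 0 ^ 2 + g.val 0 1 ^ 2 = 1 ∧ g.val 0 0 * g.val 1 0 + g.val 0 1 * g.val 1 1 = 0 ∧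
    g.val 1 0 ^ 2 + g.val 1 1 ^ 2 = 1 := by
  change g.val * 1 * g.valᵀ = 1 ↔ _
  rw [← Matrix.ext_iff]
  simp only [Fin.forall_fin_two, Matrix.mul_one, Matrix.mul_apply, Fin.sum_univ_two,
    Matrix.transpose_apply, Matrix.one_apply]
  simp only [Fin.isValue, if_true, zero_ne_one, one_ne_zero, if_false]
  constructor
  · rintro ⟨⟨h1, h2⟩, h3, h4⟩
    refine ⟨?_, h2, ?_⟩ <;> linarith
  · rintro ⟨h1, h2, h3⟩
    refine ⟨⟨?_, h2⟩, ?_, ?_⟩ <;> linarith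

theorem mem_hexagonGroup_iff {g : Γ} : g ∈ hexagonGroup ↔
    g.val 0 0 ^ 2 + g.val 0 0 * g.val 0 1 + g.val 0 1 ^ 2 = 1 ∧
    2 * (g.val 0 0 * g.val 1 0) + g.val 0 0 * g.val 1 1 + g.val 0 1 * g.val 1 0 +
      2 * (g.val 0 1 * g.val 1 1) = 1 ∧
    g.val 1 0 ^ 2 + g.val 1 0 * g.val 1 1 + g.val 1 1 ^ 2 = 1 := by
  change g.val * !![2, 1; 1, 2] * g.valᵀ = !![2, 1; 1, 2] ↔ _
  rw [← Matrix.ext_iff]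
  simp only [Fin.forall_fin_two, Matrix.mul_apply, Fin.sum_univ_two, Matrix.transpose_apply]
  simp
  constructor
  · rintro ⟨⟨h1, h2⟩, h3, h4⟩
    refine ⟨?_, ?_, ?_⟩ <;> linarith
  · rintro ⟨h1, h2, h3⟩
    refine ⟨⟨?_, ?_⟩, ?_, ?_⟩ <;> linarith

/-- The eight elements of `squareGroup`. -/
def squareElements : Finset Γ :=
  {1, -1, swapGL, -swapGL, flipGL, -flipGL, flipGL * swapGL, -(flipGL * swapGL)}

/-- The twelve elements of `hexagonGroup`. -/
def hexagonElements : Finset Γ :=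
  {1, -1, swapGL, -swapGL, rotGL, -rotGL, rotGL ^ 2, -rotGL ^ 2,
    rotGL * swapGL, -(rotGL * swapGL), rotGL ^ 2 * swapGL, -(rotGL ^ 2 * swapGL)}

/-- The four elements of `squareGroup ⊓ hexagonGroup`. -/
def edgeElements : Finset Γ := {1, -1, swapGL, -swapGL}

theorem abs_le_one_of_form {a b : ℤ} (h : a ^ 2 + a * b + b ^ 2 = 1) :
    (-1 ≤ a ∧ a ≤ 1) ∧ (-1 ≤ b ∧ b ≤ 1) := by
  refine ⟨⟨?_, ?_⟩, ?_, ?_⟩ <;> nlinarith [sq_nonneg (a + b), sq_nonneg (2 * a + b),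
    sq_nonneg (a + 2 * b)]

theorem abs_le_one_of_sq_add_sq {a b : ℤ} (h : a ^ 2 + b ^ 2 = 1) :
    (-1 ≤ a ∧ a ≤ 1) ∧ (-1 ≤ b ∧ b ≤ 1) := by
  refine ⟨⟨?_, ?_⟩, ?_, ?_⟩ <;> nlinarith [sq_nonneg a, sq_nonneg b]

theorem mem_squareElements {g : Γ} : g ∈ squareElements ↔ g ∈ squareGroup := by
  constructor
  · have : ∀ g ∈ squareElements,
        g.val 0 0 ^ 2 + g.val 0 1 ^ 2 = 1 ∧ g.val 0 0 * g.val 1 0 + g.val 0 1 * g.val 1 1 = 0 ∧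
        g.val 1 0 ^ 2 + g.val 1 1 ^ 2 = 1 := by decide
    exact fun h => mem_squareGroup_iff.2 (this g h)
  · intro h
    obtain ⟨h1, h2, h3⟩ := mem_squareGroup_iff.1 h
    obtain ⟨⟨a1, a2⟩, b1, b2⟩ := abs_le_one_of_sq_add_sq h1
    obtain ⟨⟨c1, c2⟩, d1, d2⟩ := abs_le_one_of_sq_add_sq h3
    simp only [squareElements, Finset.mem_insert, Finset.mem_singleton, ext_iff_entries]
    generalize g.val 0 0 = a at *
    generalize g.val 0 1 = b at *
    generalize g.val 1 0 = c at *
    generalize g.val 1 1 = d at *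
    interval_cases a <;> interval_cases b <;> simp at h1 <;> interval_cases c <;>
      interval_cases d <;> simp at h2 h3 <;> decide

theorem mem_hexagonElements {g : Γ} : g ∈ hexagonElements ↔ g ∈ hexagonGroup := by
  constructor
  · have : ∀ g ∈ hexagonElements,
        g.val 0 0 ^ 2 + g.val 0 0 * g.val 0 1 + g.val 0 1 ^ 2 = 1 ∧
        2 * (g.val 0 0 * g.val 1 0) + g.val 0 0 * g.val 1 1 + g.val 0 1 * g.val 1 0 +
          2 * (g.val 0 1 * g.val 1 1) = 1 ∧
        g.val 1 0 ^ 2 + g.val 1 0 * g.val 1 1 + g.val 1 1 ^ 2 = 1 := by decide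
    exact fun h => mem_hexagonGroup_iff.2 (this g h)
  · intro h
    obtain ⟨h1, h2, h3⟩ := mem_hexagonGroup_iff.1 h
    obtain ⟨⟨a1, a2⟩, b1, b2⟩ := abs_le_one_of_form h1
    obtain ⟨⟨c1, c2⟩, d1, d2⟩ := abs_le_one_of_form h3
    simp only [hexagonElements, Finset.mem_insert, Finset.mem_singleton, ext_iff_entries]
    generalize g.val 0 0 = a at *
    generalize g.val 0 1 = b at *
    generalize g.val 1 0 = c at *
    generalize g.val 1 1 = d at *
    interval_cases a <;> interval_cases b <;> simp at h1 <;> interval_cases c <;>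
      interval_cases d <;> simp at h2 h3 <;> decide

theorem finite_squareGroup : (squareGroup : Set Γ).Finite :=
  squareElements.finite_toSet.subset fun _ => mem_squareElements.2

instance : Finite squareGroup := finite_squareGroup

theorem finite_hexagonGroup : (hexagonGroup : Set Γ).Finite :=
  hexagonElements.finite_toSet.subset fun _ => mem_hexagonElements.2

instance : Finite hexagonGroup := finite_hexagonGroup

theorem mem_edgeElements {g : Γ} : g ∈ edgeElements ↔ g ∈ squareGroup ⊓ hexagonGroup := by
  rw [Subgroup.mem_inf, ← mem_squareElements, ← mem_hexagonElements]
  constructor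
  · revert g
    decide
  · rintro ⟨h1, h2⟩
    have : ∀ g ∈ squareElements, g ∈ hexagonElements → g ∈ edgeElements := by decide
    exact this g h1 h2

theorem mem_edgeGroup_iff {g : Γ} : g ∈ squareGroup ⊓ hexagonGroup ↔
    g.val 0 0 * g.val 1 0 = 0 ∧ g.val 0 1 * g.val 1 1 = 0 ∧
      g.val 0 0 * g.val 1 1 + g.val 0 1 * g.val 1 0 = 1 := by
  rw [← mem_edgeElements]
  constructor
  · revert g
    decide
  · rintro ⟨h1, h2, h3⟩
    simp only [edgeElements, Finset.mem_insert, Finset.mem_singleton, ext_iff_entries]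
    generalize g.val 0 0 = a at *
    generalize g.val 0 1 = b at *
    generalize g.val 1 0 = c at *
    generalize g.val 1 1 = d at *
    have e1 : (1 : Γ).val 0 0 = 1 ∧ (1 : Γ).val 0 1 = 0 ∧ (1 : Γ).val 1 0 = 0 ∧
      (1 : Γ).val 1 1 = 1 := by decide
    have e2 : (-1 : Γ).val 0 0 = -1 ∧ (-1 : Γ).val 0 1 = 0 ∧ (-1 : Γ).val 1 0 = 0 ∧
      (-1 : Γ).val 1 1 = -1 := by decide
    have e3 : (swapGL : Γ).val 0 0 = 0 ∧ (swapGL : Γ).val 0 1 = 1 ∧ (swapGL : Γ).val 1 0 = 1 ∧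
      (swapGL : Γ).val 1 1 = 0 := by decide
    have e4 : (-swapGL : Γ).val 0 0 = 0 ∧ (-swapGL : Γ).val 0 1 = -1 ∧ (-swapGL : Γ).val 1 0 = -1 ∧
      (-swapGL : Γ).val 1 1 = 0 := by decide
    simp only [e1, e2, e3, e4]
    rcases mul_eq_zero.1 h1 with rfl | rfl <;> rcases mul_eq_zero.1 h2 with rfl | rfl
    · simp at h3
    · simp only [zero_mul, zero_add] at h3
      rcases Int.mul_eq_one_iff_eq_one_or_neg_one.1 h3 with ⟨rfl, rfl⟩ | ⟨rfl, rfl⟩ <;> simp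
    · simp only [mul_zero, add_zero] at h3
      rcases Int.mul_eq_one_iff_eq_one_or_neg_one.1 h3 with ⟨rfl, rfl⟩ | ⟨rfl, rfl⟩ <;> simp
    · simp at h3

/-- `SL₂(ℤ)` is generated by `S`, which lies in `squareGroup`, and `T = rotGL * S⁻¹`; the elements
of determinant `-1` are reached through `swapGL`. -/
theorem closure_square_rotation : Subgroup.closure ((squareGroup : Set Γ) ∪ {rotGL}) = ⊤ := by
  set K := Subgroup.closure ((squareGroup : Set Γ) ∪ {rotGL})
  have hsq : ∀ g ∈ squareElements, g ∈ K := fun g hg =>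
    Subgroup.subset_closure (Or.inl (mem_squareElements.1 hg))
  have hrot : rotGL ∈ K := Subgroup.subset_closure (Or.inr rfl)
  have hS : SpecialLinearGroup.toGL ModularGroup.S = -(flipGL * swapGL) := by
    rw [ext_iff_entries]; decide
  have hT : SpecialLinearGroup.toGL ModularGroup.T = rotGL * (flipGL * swapGL) := by
    rw [ext_iff_entries]; decide
  have hSL : ∀ s, SpecialLinearGroup.toGL s ∈ K := by
    have hle : (⊤ : Subgroup (SpecialLinearGroup (Fin 2) ℤ)) ≤ K.comap SpecialLinearGroup.toGL := by
      rw [← SpecialLinearGroup.SL2Z_generators, Subgroup.closure_le]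
      rintro s (rfl | rfl)
      · change _ ∈ K
        rw [hS]
        exact hsq _ (by decide)
      · change _ ∈ K
        rw [hT]
        exact mul_mem hrot (hsq _ (by decide))
    exact fun s => hle (Subgroup.mem_top s)
  refine eq_top_iff.2 fun g _ => ?_
  rcases Int.isUnit_iff.1 ((Matrix.isUnit_iff_isUnit_det _).1 g.isUnit) with h | h
  · have : g = SpecialLinearGroup.toGL ⟨g.val, h⟩ := Units.ext rfl
    rw [this]
    exact hSL _
  · have hd : (g * swapGL).val.det = 1 := by
      rw [Units.val_mul, det_mul, h]
      decide
    have : g * swapGL = SpecialLinearGroup.toGL ⟨(g * swapGL).val, hd⟩ := Units.ext rfl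
    rw [← K.mul_mem_cancel_right (hsq swapGL (by decide)), this]
    exact hSL _

theorem closure_square_hexagon :
    Subgroup.closure ((squareGroup : Set Γ) ∪ (hexagonGroup : Set Γ)) = ⊤ := by
  refine eq_top_iff.2 (closure_square_rotation ▸ Subgroup.closure_mono ?_)
  exact Set.union_subset_union_right _
    (Set.singleton_subset_iff.2 (mem_hexagonElements.1 (by decide)))

theorem hexagonGroup_le_closure :
    hexagonGroup ≤ Subgroup.closure
      (((squareGroup ⊓ hexagonGroup : Subgroup Γ) : Set Γ) ∪ {rotGL}) := by
  set K := Subgroup.closure (((squareGroup ⊓ hexagonGroup : Subgroup Γ) : Set Γ) ∪ {rotGL})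
  have hrot : rotGL ∈ K := Subgroup.subset_closure (Or.inr rfl)
  have hedge : ∀ g ∈ edgeElements, g ∈ K := fun g hg =>
    Subgroup.subset_closure (Or.inl (mem_edgeElements.1 hg))
  have hword : ∀ g ∈ hexagonElements, ∃ j < 3, ∃ e ∈ edgeElements, g = rotGL ^ j * e := by
    decide
  intro g hg
  obtain ⟨j, -, e, he, rfl⟩ := hword g (mem_hexagonElements.2 hg)
  exact mul_mem (pow_mem hrot j) (hedge e he)

/-- The indicator function of the matrices `k` whose rows have positive scalar product. In the upper
half-plane this says that `k • i` has positive real part, i.e. that it lies beyond the edge from `i`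
to `exp (π i / 3)` of the tree of `GL₂(ℤ)`, as seen from `i`. -/
def acute (k : Γ) : ℤ :=
  if 0 < k.val 0 0 * k.val 1 0 + k.val 0 1 * k.val 1 1 then 1 else 0

theorem acute_mul_of_mem (k : Γ) {a : Γ} (ha : a ∈ squareGroup) : acute (k * a) = acute k := by
  have key : ∀ k : Γ, (k.val * k.valᵀ) 0 1 = k.val 0 0 * k.val 1 0 + k.val 0 1 * k.val 1 1 :=
    fun k => by simp [Matrix.mul_apply]
  have h : (k * a).val * (k * a).valᵀ = k.val * k.valᵀ := by
    have h1 : a.val * a.valᵀ = 1 := by simpa using (show a.val * 1 * a.valᵀ = 1 from ha)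
    rw [Units.val_mul, transpose_mul, Matrix.mul_assoc, ← Matrix.mul_assoc a.val, h1,
      Matrix.one_mul]
  simp only [acute, ← key, h]

open Classical in
/-- Right translation by `rotGL` changes `acute` only at the stabilizer of the edge and at one of
its cosets. -/
theorem acute_mul_rotation_sub (k : Γ) : acute (k * rotGL) - acute k =
    (if k ∈ squareGroup ⊓ hexagonGroup then 1 else 0) -
      if k * rotGL ∈ squareGroup ⊓ hexagonGroup then 1 else 0 := by
  have hdet := sq_det_eq_one k
  have e : (k * rotGL).val 0 0 = k.val 0 0 + k.val 0 1 ∧ (k * rotGL).val 0 1 = -k.val 0 0 ∧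
      (k * rotGL).val 1 0 = k.val 1 0 + k.val 1 1 ∧ (k * rotGL).val 1 1 = -k.val 1 0 := by
    simp [rotGL, Matrix.mul_apply]
  simp only [acute, mem_edgeGroup_iff, e]
  generalize k.val 0 0 = a at *
  generalize k.val 0 1 = b at *
  generalize k.val 1 0 = c at *
  generalize k.val 1 1 = d at *
  -- With `p = a * c`, `q = b * d`, `s = a * d + b * c`, the two scalar products are `p + q` and
  -- `2 * p + q + s`, and `s ^ 2 = 1 + 4 * p * q` forces them to have the same sign unless
  -- `p * q = 0`.
  have hs : (a * d + b * c) ^ 2 = 1 + 4 * ((a * c) * (b * d)) := by linear_combination hdet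
  have e1 : (a + b) * (c + d) + -a * -c = 2 * (a * c) + b * d + (a * d + b * c) := by ring
  have e2 : (a + b) * (c + d) = a * c + b * d + (a * d + b * c) := by ring
  have e3 : -a * -c = a * c := by ring
  have e4 : (a + b) * -c + -a * (c + d) = -(2 * (a * c) + (a * d + b * c)) := by ring
  rw [e1, e2, e3, e4]
  generalize a * c = p at *
  generalize b * d = q at *
  generalize a * d + b * c = s at *
  clear e e1 e2 e3 e4 hdet
  have hpq : 0 ≤ p * q := by nlinarith [sq_nonneg s]
  rcases hpq.eq_or_lt with h0 | hpos
  · have hs1 : s = 1 ∨ s = -1 := mul_self_eq_one_iff.1 (by rw [← sq, hs, ← h0]; norm_num)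
    rcases mul_eq_zero.1 h0.symm with rfl | rfl <;> rcases hs1 with hs1 | hs1 <;>
      split_ifs <;> omega
  · rcases pos_and_pos_or_neg_and_neg_of_mul_pos hpos with ⟨hp, hq⟩ | ⟨hp, hq⟩
    · have : -(p + q) ≤ s := by
        by_contra! hlt
        nlinarith [sq_nonneg (p - q)]
      split_ifs <;> omega
    · have : s ≤ -(p + q) := by
        by_contra! hlt
        nlinarith [sq_nonneg (p - q)]
      split_ifs <;> omega

end BinaryGL

/-! ### Traces and invariants on binary forms -/

namespace BinaryForm

open Matrix Module BinaryGL

local notation "Γ" => GeneralLinearGroup (Fin 2) ℤ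

/-- The exponent of the monomial `X ^ i * Y ^ j`. -/
noncomputable abbrev expo (i j : ℕ) : Fin 2 →₀ ℕ := Finsupp.single 0 i + Finsupp.single 1 j

theorem expo_inj {i j i' j' : ℕ} : expo i j = expo i' j' ↔ i = i' ∧ j = j' := by
  refine ⟨fun h => ?_, by rintro ⟨rfl, rfl⟩; rfl⟩
  have h0 := DFunLike.congr_fun h 0
  have h1 := DFunLike.congr_fun h 1
  simpa using And.intro h0 h1

theorem X_pow_mul_X_pow (i j : ℕ) :
    (X 0 ^ i * X 1 ^ j : MvPolynomial (Fin 2) ℤ) = monomial (expo i j) 1 := by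
  rw [X_pow_eq_monomial, X_pow_eq_monomial, monomial_mul, one_mul]

theorem coeff_X_pow_mul_X_pow (i j i' j' : ℕ) :
    coeff (expo i j) (X 0 ^ i' * X 1 ^ j' : MvPolynomial (Fin 2) ℤ) =
      if i' = i ∧ j' = j then 1 else 0 := by
  rw [X_pow_mul_X_pow, coeff_monomial]
  simp only [expo_inj]

/-- The monomial `X ^ i * Y ^ (n - i)` as a binary form of degree `n`. -/
noncomputable def mono (n : ℕ) (i : Fin (n + 1)) : BinaryForm n :=
  ⟨X 0 ^ (i : ℕ) * X 1 ^ (n - i), by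
    have h := ((isHomogeneous_X ℤ (0 : Fin 2)).pow i).mul
      ((isHomogeneous_X ℤ (1 : Fin 2)).pow (n - i))
    rwa [one_mul, one_mul, Nat.add_sub_cancel' (Nat.lt_succ_iff.1 i.2)] at h⟩

/-- The coefficients of a binary form. -/
noncomputable def coeffs (n : ℕ) : BinaryForm n →ₗ[ℤ] (Fin (n + 1) → ℤ) :=
  LinearMap.pi fun i => lcoeff ℤ (expo i (n - i)) ∘ₗ Submodule.subtype _

theorem coeffs_apply (n : ℕ) (P : BinaryForm n) (i : Fin (n + 1)) :
    coeffs n P i = coeff (expo i (n - i)) P.1 := rfl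

theorem coeffs_mono (n : ℕ) (i : Fin (n + 1)) : coeffs n (mono n i) = Pi.single i 1 := by
  ext j
  rw [coeffs_apply, mono, coeff_X_pow_mul_X_pow, Pi.single_apply]
  refine if_congr ⟨fun h => Fin.ext h.1.symm, ?_⟩ rfl rfl
  rintro rfl
  exact ⟨rfl, rfl⟩

theorem coeffs_injective (n : ℕ) : Function.Injective (coeffs n) := by
  rw [injective_iff_map_eq_zero]
  refine fun P hP => Subtype.ext (MvPolynomial.ext _ _ fun d => ?_)
  by_cases hd : d.degree = n
  · have hsum : d 0 + d 1 = n := by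
      rw [← hd, Finsupp.degree_eq_sum, Fin.sum_univ_two]
    have he : d = expo (d 0) (n - d 0) := by
      ext i
      fin_cases i
      · simp
      · simp [← hsum]
    have h := congrFun hP ⟨d 0, by omega⟩
    rw [coeffs_apply] at h
    rw [he]
    exact h
  · exact P.2.coeff_eq_zero hd

theorem coeffs_surjective (n : ℕ) : Function.Surjective (coeffs n) := fun c =>
  ⟨∑ i, c i • mono n i, by
    simp only [map_sum, map_smul, coeffs_mono]
    ext j
    simp [Finset.sum_apply, Pi.single_apply]⟩

/-- The monomial basis of the binary forms of degree `n`. -/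
noncomputable def basis (n : ℕ) : Basis (Fin (n + 1)) ℤ (BinaryForm n) :=
  Basis.ofEquivFun (LinearEquiv.ofBijective (coeffs n) ⟨coeffs_injective n, coeffs_surjective n⟩)

theorem basis_repr (n : ℕ) (P : BinaryForm n) (i : Fin (n + 1)) :
    (basis n).repr P i = coeffs n P i := rfl

theorem basis_apply (n : ℕ) (i : Fin (n + 1)) : basis n i = mono n i := by
  apply (basis n).repr.injective
  ext j
  rw [Basis.repr_self, basis_repr, coeffs_mono, Finsupp.single_eq_pi_single]

instance (n : ℕ) : Module.Finite ℤ (BinaryForm n) := Module.Finite.of_basis (basis n)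

instance (n : ℕ) : Module.Free ℤ (BinaryForm n) := Module.Free.of_basis (basis n)

theorem rep_coe {n : ℕ} (g : Γ) (P : BinaryForm n) :
    (binaryFormRep n g P).1 = binarySubst g.val P.1 := rfl

theorem rep_mono (n : ℕ) (g : Γ) (i : Fin (n + 1)) :
    (binaryFormRep n g (mono n i)).1 =
      (C (g.val 0 0) * X 0 + C (g.val 1 0) * X 1) ^ (i : ℕ) *
        (C (g.val 0 1) * X 0 + C (g.val 1 1) * X 1) ^ (n - i) := by
  simp [rep_coe, mono, binarySubst]

theorem trace_rep (n : ℕ) (g : Γ) : LinearMap.trace ℤ _ (binaryFormRep n g) =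
    ∑ i ∈ Finset.range (n + 1), coeff (expo i (n - i))
      ((C (g.val 0 0) * X 0 + C (g.val 1 0) * X 1) ^ i *
        (C (g.val 0 1) * X 0 + C (g.val 1 1) * X 1) ^ (n - i)) := by
  rw [LinearMap.trace_eq_matrix_trace ℤ (basis n), Matrix.trace, Finset.sum_range]
  refine Finset.sum_congr rfl fun i _ => ?_
  rw [diag_apply, LinearMap.toMatrix_apply, basis_repr, basis_apply, coeffs_apply, rep_mono]

theorem trace_one (n : ℕ) : LinearMap.trace ℤ _ (binaryFormRep n 1) = n + 1 := by
  rw [map_one, LinearMap.trace_one, Module.finrank_eq_card_basis (basis n)]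
  simp

theorem trace_swap {n : ℕ} (hn : Even n) : LinearMap.trace ℤ _ (binaryFormRep n swapGL) = 1 := by
  have e : swapGL.val 0 0 = 0 ∧ swapGL.val 0 1 = 1 ∧
    swapGL.val 1 0 = 1 ∧ swapGL.val 1 1 = 0 := by decide
  obtain ⟨m, rfl⟩ := hn
  rw [trace_rep, Finset.sum_eq_single_of_mem m (by simp)]
  · simp only [e, map_zero, map_one, zero_mul, one_mul, zero_add, add_zero]
    rw [mul_comm, coeff_X_pow_mul_X_pow, if_pos (by omega)]
  · intro i hi hne
    rw [Finset.mem_range] at hi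
    simp only [e, map_zero, map_one, zero_mul, one_mul, zero_add, add_zero]
    rw [mul_comm, coeff_X_pow_mul_X_pow, if_neg (by omega)]

theorem trace_reflection {n : ℕ} (hn : Even n) :
    LinearMap.trace ℤ _ (binaryFormRep n flipGL) = 1 := by
  have e : flipGL.val 0 0 = 1 ∧ flipGL.val 0 1 = 0 ∧
    flipGL.val 1 0 = 0 ∧ flipGL.val 1 1 = -1 := by decide
  have h : ∀ i ∈ Finset.range (n + 1), coeff (expo i (n - i))
      ((C (flipGL.val 0 0) * X 0 + C (flipGL.val 1 0) * X 1) ^ i *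
        (C (flipGL.val 0 1) * X 0 + C (flipGL.val 1 1) * X 1) ^ (n - i)) =
      (-1 : ℤ) ^ i := by
    intro i hi
    rw [Finset.mem_range] at hi
    simp only [e, map_zero, map_one, zero_mul, one_mul, zero_add, add_zero]
    rw [mul_pow, ← map_pow, mul_left_comm, coeff_C_mul, coeff_X_pow_mul_X_pow,
      if_pos ⟨rfl, rfl⟩, mul_one]
    have h1 : (-1 : ℤ) ^ (n - i) * (-1) ^ i = 1 := by
      rw [← pow_add, Nat.sub_add_cancel (by omega), hn.neg_one_pow]
    rcases neg_one_pow_eq_or ℤ i with h2 | h2 <;> rw [h2] at h1 ⊢ <;> linarith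
  rw [trace_rep, Finset.sum_congr rfl h, neg_one_geom_sum, if_neg]
  simpa [Nat.even_add_one] using hn

theorem trace_reflection_mul_swap {n : ℕ} (hn : Even n) :
    LinearMap.trace ℤ _ (binaryFormRep n (flipGL * swapGL)) = (-1) ^ (n / 2) := by
  obtain ⟨m, rfl⟩ := hn
  have e : (flipGL * swapGL).val 0 0 = 0 ∧ (flipGL * swapGL).val 0 1 = 1 ∧
    (flipGL * swapGL).val 1 0 = -1 ∧ (flipGL * swapGL).val 1 1 = 0 := by decide
  rw [trace_rep, Finset.sum_eq_single_of_mem m (by simp)]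
  · simp only [e, map_zero, map_one, zero_mul, one_mul, zero_add, add_zero]
    rw [mul_pow, ← map_pow, mul_assoc, coeff_C_mul, mul_comm (X 1 ^ m), coeff_X_pow_mul_X_pow,
      if_pos (by omega), mul_one]
    congr 1
    omega
  · intro i hi hne
    rw [Finset.mem_range] at hi
    simp only [e, map_zero, map_one, zero_mul, one_mul, zero_add, add_zero]
    rw [mul_pow, ← map_pow, mul_assoc, coeff_C_mul, mul_comm (X 1 ^ i), coeff_X_pow_mul_X_pow,
      if_neg (by omega), mul_zero]

/-- Pascal's rule makes the alternating diagonal sums satisfy `a (n + 2) = -(a n + a (n + 1))`, the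
recursion of `eta`. -/
theorem sum_neg_one_pow_mul_choose : ∀ n : ℕ,
    ∑ p ∈ Finset.HasAntidiagonal.antidiagonal n, (-1 : ℤ) ^ p.1 * (p.1.choose p.2 : ℤ) = eta n := by
  have hrec : ∀ n : ℕ, eta (n + 2) = -(eta n + eta (n + 1)) := fun n => by
    unfold eta
    split_ifs <;> omega
  refine Nat.twoStepInduction (by decide) (by decide) fun n h1 h2 => ?_
  rw [hrec, ← h1, ← h2, Finset.Nat.antidiagonal_succ_succ', Finset.Nat.antidiagonal_succ']
  simp [Nat.choose_succ_succ, Finset.sum_add_distrib, pow_succ, mul_add, add_left_comm]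
  ring

/-- `rotGL ^ 2` maps `X` to `Y` and `Y` to `-X - Y`. -/
theorem trace_rotation_sq (n : ℕ) :
    LinearMap.trace ℤ _ (binaryFormRep n (rotGL ^ 2)) = eta n := by
  have e : (rotGL ^ 2).val 0 0 = 0 ∧ (rotGL ^ 2).val 0 1 = -1 ∧
    (rotGL ^ 2).val 1 0 = 1 ∧ (rotGL ^ 2).val 1 1 = -1 := by decide
  rw [trace_rep, ← sum_neg_one_pow_mul_choose,
    ← Finset.Nat.sum_antidiagonal_swap, Finset.Nat.sum_antidiagonal_eq_sum_range_succ_mk]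
  refine Finset.sum_congr rfl fun i hi => ?_
  rw [Finset.mem_range] at hi
  simp only [e, map_zero, map_one, zero_mul, one_mul, zero_add, Prod.fst_swap, Prod.snd_swap]
  rw [← mul_add, mul_pow, ← map_pow, mul_left_comm, coeff_C_mul, add_pow, Finset.mul_sum,
    coeff_sum]
  congr 1
  have h : ∀ k ∈ Finset.range (n - i + 1), coeff (expo i (n - i))
      (X 1 ^ i * (X 0 ^ k * X 1 ^ (n - i - k) * ((n - i).choose k : MvPolynomial (Fin 2) ℤ))) =
      if i = k then ((n - i).choose k : ℤ) else 0 := by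
    intro k hk
    rw [Finset.mem_range] at hk
    have h1 : (X 1 ^ i * (X 0 ^ k * X 1 ^ (n - i - k) *
        ((n - i).choose k : MvPolynomial (Fin 2) ℤ))) =
        C ((n - i).choose k : ℤ) * (X 0 ^ k * X 1 ^ (n - k)) := by
      have : n - k = i + (n - i - k) := by omega
      rw [this, pow_add]
      simp
      ring
    rw [h1, coeff_C_mul, coeff_X_pow_mul_X_pow]
    by_cases hik : i = k
    · subst hik; simp
    · rw [if_neg (by omega), if_neg hik, mul_zero]
  rw [Finset.sum_congr rfl h, Finset.sum_ite_eq]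
  split_ifs with hmem
  · rfl
  · rw [Finset.mem_range, not_lt] at hmem
    rw [Nat.choose_eq_zero_of_lt (by omega), Nat.cast_zero]

/-- `-1` acts trivially on forms of even degree. -/
theorem rep_neg {n : ℕ} (hn : Even n) (g : Γ) : binaryFormRep n (-g) = binaryFormRep n g := by
  have h : binaryFormRep n (-1) = 1 := by
    refine (basis n).ext fun i => Subtype.ext ?_
    rw [basis_apply, rep_mono]
    have e : (-1 : Γ).val 0 0 = -1 ∧ (-1 : Γ).val 0 1 = 0 ∧ (-1 : Γ).val 1 0 = 0 ∧
      (-1 : Γ).val 1 1 = -1 := by decide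
    simp only [e, map_zero, zero_mul, zero_add, add_zero]
    rw [mul_pow, mul_pow, mul_mul_mul_comm, ← pow_add,
      Nat.add_sub_cancel' (Nat.lt_succ_iff.1 i.2), ← map_pow, hn.neg_one_pow, map_one, one_mul]
    rfl
  rw [← neg_one_mul, map_mul, h, one_mul]

theorem trace_conj (n : ℕ) (g h : Γ) : LinearMap.trace ℤ _ (binaryFormRep n (h * g * h⁻¹)) =
    LinearMap.trace ℤ _ (binaryFormRep n g) := by
  rw [map_mul, LinearMap.trace_mul_comm, ← map_mul, ← mul_assoc, inv_mul_cancel, one_mul]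

theorem trace_rotation {n : ℕ} (hn : Even n) :
    LinearMap.trace ℤ _ (binaryFormRep n rotGL) = eta n := by
  have h : rotGL = -(swapGL * rotGL ^ 2 * swapGL⁻¹) := by decide
  rw [h, rep_neg hn, trace_conj, trace_rotation_sq]

theorem trace_rotation_mul_swap {n : ℕ} (hn : Even n) :
    LinearMap.trace ℤ _ (binaryFormRep n (rotGL * swapGL)) = 1 := by
  have h : rotGL * swapGL = -(rotGL⁻¹ * swapGL * rotGL⁻¹⁻¹) := by decide
  rw [h, rep_neg hn, trace_conj, trace_swap hn]

theorem trace_rotation_sq_mul_swap {n : ℕ} (hn : Even n) :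
    LinearMap.trace ℤ _ (binaryFormRep n (rotGL ^ 2 * swapGL)) = 1 := by
  have h : rotGL ^ 2 * swapGL = rotGL * swapGL * rotGL⁻¹ := by decide
  rw [h, trace_conj, trace_swap hn]

theorem sum_trace_eq (n : ℕ) (H : Subgroup Γ) (s : Finset Γ) (hs : ∀ g, g ∈ s ↔ g ∈ H) :
    ∑ g ∈ s, LinearMap.trace ℤ _ (binaryFormRep n g) =
      (s.card : ℤ) * finrank ℤ ((binaryFormRep n).fixedBy H) := by
  have : Fintype H := Fintype.subtype s hs
  rw [Finset.sum_subtype s hs, Representation.sum_trace_eq_card_mul_finrank,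
    Fintype.card_of_subtype s hs]

theorem finrank_fixedBy_square {n : ℕ} (hn : Even n) :
    4 * (finrank ℤ ((binaryFormRep n).fixedBy squareGroup) : ℤ) = n + 3 + (-1) ^ (n / 2) := by
  have h := sum_trace_eq n squareGroup squareElements fun _ => mem_squareElements
  have hc : squareElements.card = 8 := by decide
  rw [hc, squareElements] at h
  repeat rw [Finset.sum_insert (by decide)] at h
  rw [Finset.sum_singleton] at h
  simp only [rep_neg hn, trace_one, trace_swap hn, trace_reflection hn,
    trace_reflection_mul_swap hn] at h
  push_cast at h
  linarith

theorem finrank_fixedBy_hexagon {n : ℕ} (hn : Even n) :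
    6 * (finrank ℤ ((binaryFormRep n).fixedBy hexagonGroup) : ℤ) = n + 4 + 2 * eta n := by
  have h := sum_trace_eq n hexagonGroup hexagonElements fun _ => mem_hexagonElements
  have hc : hexagonElements.card = 12 := by decide
  rw [hc, hexagonElements] at h
  repeat rw [Finset.sum_insert (by decide)] at h
  rw [Finset.sum_singleton] at h
  simp only [rep_neg hn, trace_one, trace_swap hn, trace_rotation hn, trace_rotation_sq,
    trace_rotation_mul_swap hn, trace_rotation_sq_mul_swap hn] at h
  push_cast at h
  linarith

theorem finrank_fixedBy_edge {n : ℕ} (hn : Even n) :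
    2 * (finrank ℤ ((binaryFormRep n).fixedBy (squareGroup ⊓ hexagonGroup)) : ℤ) = n + 2 := by
  have h := sum_trace_eq n (squareGroup ⊓ hexagonGroup) edgeElements fun _ => mem_edgeElements
  have hc : edgeElements.card = 4 := by decide
  rw [hc, edgeElements] at h
  repeat rw [Finset.sum_insert (by decide)] at h
  rw [Finset.sum_singleton] at h
  simp only [rep_neg hn, trace_one, trace_swap hn] at h
  push_cast at h
  linarith

/-- The matrices `!![1, k; 0, 1]`. -/
def shear (k : ℤ) : Γ :=
  ⟨!![1, k; 0, 1], !![1, -k; 0, 1], by simp [Matrix.one_fin_two], by simp [Matrix.one_fin_two]⟩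

/-- An invariant form `P` has `P(1, k) = P(1, 0)` for all integers `k`, so that it is a multiple of
`X ^ n`; by symmetry in `X` and `Y` it vanishes. -/
theorem fixedBy_top {n : ℕ} (hn : 1 ≤ n) : (binaryFormRep n).fixedBy ⊤ = ⊥ := by
  refine eq_bot_iff.2 fun P hP => ?_
  have hfix : ∀ g : Γ, binaryFormRep n g P = P := fun g =>
    Representation.mem_fixedBy.1 hP g (Subgroup.mem_top g)
  have hsum : P = ∑ i, coeffs n P i • mono n i := by
    simpa only [basis_apply, basis_repr] using ((basis n).sum_repr P).symm
  -- `f = P(1, Y)`.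
  let f : Polynomial ℤ := aeval ![1, Polynomial.X] P.1
  have hf : f = ∑ i : Fin (n + 1), Polynomial.monomial (n - i) (coeffs n P i) := by
    have h1 : P.1 = ∑ i, coeffs n P i • (mono n i).1 := by
      conv_lhs => rw [hsum]
      simp
    change aeval ![1, Polynomial.X] P.1 = _
    rw [h1, map_sum]
    refine Finset.sum_congr rfl fun i _ => ?_
    simp [mono, ← Polynomial.C_mul_X_pow_eq_monomial]
  have heval : ∀ k : ℤ, f.eval k = f.eval 0 := fun k => by
    have h1 : ∀ y : ℤ, f.eval y = aeval ![1, y] P.1 := fun y => by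
      have h2 : (Polynomial.aeval y).comp (aeval ![1, Polynomial.X]) =
          (aeval ![1, y] : MvPolynomial (Fin 2) ℤ →ₐ[ℤ] ℤ) := by
        ext j
        fin_cases j <;> simp
      rw [← h2, AlgHom.comp_apply, Polynomial.coe_aeval_eq_eval]
    rw [h1, h1]
    have h2 : binarySubst (shear k).val P.1 = P.1 := congrArg Subtype.val (hfix (shear k))
    have h3 : (aeval ![1, 0]).comp (binarySubst (shear k).val) =
        (aeval ![1, k] : MvPolynomial (Fin 2) ℤ →ₐ[ℤ] ℤ) := by
      ext j
      fin_cases j <;> simp [binarySubst, shear]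
    conv_rhs => rw [← h2]
    rw [← AlgHom.comp_apply, h3]
  have hconst : f = Polynomial.C (f.eval 0) := by
    refine Polynomial.funext fun k => ?_
    rw [heval, Polynomial.eval_C]
  have hcoeff : ∀ i : Fin (n + 1), (i : ℕ) ≠ n → coeffs n P i = 0 := fun i hi => by
    have h1 : f.coeff (n - i) = coeffs n P i := by
      rw [hf, Polynomial.finsetSum_coeff, Finset.sum_eq_single_of_mem i (Finset.mem_univ _)]
      · simp
      · intro j _ hj
        rw [Polynomial.coeff_monomial, if_neg]
        intro h
        exact hj (Fin.ext (by omega))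
    rw [← h1, hconst, Polynomial.coeff_C, if_neg (by omega)]
  have hP' : P = coeffs n P (Fin.last n) • mono n (Fin.last n) := by
    conv_lhs => rw [hsum]
    refine Finset.sum_eq_single_of_mem _ (Finset.mem_univ _) fun i _ hi => ?_
    rw [hcoeff i (fun h => hi (Fin.ext h)), zero_smul]
  have hlast : coeffs n P (Fin.last n) = 0 := by
    have h1 := hfix swapGL
    rw [hP', map_smul] at h1
    have h2 := congrArg (fun Q => coeffs n Q (Fin.last n)) h1
    simp only [map_smul, Pi.smul_apply, coeffs_mono, Pi.single_eq_same] at h2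
    rw [coeffs_apply n (binaryFormRep n swapGL _), rep_mono] at h2
    have h3 : coeff (expo n 0) (X 0 ^ 0 * X 1 ^ n : MvPolynomial (Fin 2) ℤ) = 0 := by
      rw [coeff_X_pow_mul_X_pow, if_neg (by omega)]
    simp [swapGL] at h2 h3
    simp [h3] at h2
    omega
  rw [hP', hlast, zero_smul]
  exact zero_mem _

end BinaryForm

/-! ### The rank of the first cohomology -/

open BinaryGL Module in
/-- The Mayer-Vietoris rank formula for `GL₂(ℤ)`. -/
theorem BinaryForm.finrank_H1_add {n : ℕ} (hn : 1 ≤ n) :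
    finrank ℤ (H1GL2 n) + finrank ℤ ((binaryFormRep n).fixedBy squareGroup) +
      finrank ℤ ((binaryFormRep n).fixedBy hexagonGroup) =
        finrank ℤ ((binaryFormRep n).fixedBy (squareGroup ⊓ hexagonGroup)) := by
  classical
  have hfin : Finite (squareGroup ⊓ hexagonGroup : Subgroup _) :=
    Finite.of_injective (Subgroup.inclusion inf_le_left) (Subgroup.inclusion_injective _)
  have hacute : groupCohomology.AlmostInvariant acute := by
    refine .of_closure closure_square_rotation fun g hg => ?_
    rcases hg with hg | rfl
    · simp [acute_mul_of_mem _ hg]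
    · have hC : ((squareGroup ⊓ hexagonGroup : Subgroup (Matrix.GeneralLinearGroup (Fin 2) ℤ)) :
          Set (Matrix.GeneralLinearGroup (Fin 2) ℤ)).Finite := Set.toFinite _
      refine (hC.union (hC.preimage (mul_left_injective rotGL).injOn)).subset fun k hk => ?_
      by_contra h
      simp only [Set.mem_union, Set.mem_preimage, SetLike.mem_coe, not_or] at h
      have h1 := acute_mul_rotation_sub k
      rw [if_neg h.1, if_neg h.2, sub_self, sub_eq_zero] at h1
      exact hk h1
  set Φ := groupCohomology.almostInvariantCocycle (binaryFormRep n) hacute with hΦ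
  have hΦA : ∀ m, ∀ a ∈ squareGroup, Φ m a = 0 := fun m a ha => by
    rw [hΦ, groupCohomology.almostInvariantCocycle_apply]
    simp [acute_mul_of_mem _ ha]
  set N : ℤ := (Nat.card (squareGroup ⊓ hexagonGroup : Subgroup _) : ℤ) with hN
  have hΦB : ∀ m ∈ (binaryFormRep n).fixedBy (squareGroup ⊓ hexagonGroup), ∀ b ∈ hexagonGroup,
      Φ m b = N • (m - binaryFormRep n b m) := fun m hm b hb => by
    have hrot : Φ m rotGL = N • (m - binaryFormRep n rotGL m) :=
      groupCohomology.almostInvariantCocycle_apply_eq_smul hacute _ acute_mul_rotation_sub hm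
    have h := groupCohomology.cocycles₁_eq_of_mem_closure (f := Φ m)
      (f' := groupCohomology.principalCocycle (binaryFormRep n) (-(N • m))) (fun g hg => ?_)
      (hexagonGroup_le_closure hb)
    · rw [h, groupCohomology.principalCocycle_apply, map_neg, map_smul, smul_sub]
      abel
    · rcases hg with hg | rfl
      · rw [hΦA m g hg.1, groupCohomology.principalCocycle_apply, map_neg, map_smul,
          Representation.mem_fixedBy.1 hm g hg, sub_self]
      · rw [hrot, groupCohomology.principalCocycle_apply, map_neg, map_smul, smul_sub]
        abel
  have h := groupCohomology.finrank_H1_add_finrank_fixedBy squareGroup hexagonGroup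
    closure_square_hexagon (N := N) (by rw [hN]; exact_mod_cast Nat.card_pos.ne') Φ hΦA hΦB
  rwa [fixedBy_top hn, finrank_bot, add_zero] at h

theorem theorem6p4 (n : ℕ) (hn : Even n) (hn1 : 1 ≤ n) :
    Module.Finite ℤ (H1GL2 n) ∧
    (Module.finrank ℤ (H1GL2 n) : ℚ) =
      ((n : ℚ) - 5 + 3 * (-1) ^ (n / 2 + 1) - 4 * (eta n : ℚ)) / 12 ∧
    ((n : ℚ) - 12) / 12 ≤ (Module.finrank ℤ (H1GL2 n) : ℚ) := by
  have hrank : (Module.finrank ℤ (H1GL2 n) : ℚ) =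
      ((n : ℚ) - 5 + 3 * (-1) ^ (n / 2 + 1) - 4 * (eta n : ℚ)) / 12 := by
    have h := BinaryForm.finrank_H1_add hn1
    have hA := BinaryForm.finrank_fixedBy_square hn
    have hB := BinaryForm.finrank_fixedBy_hexagon hn
    have hC := BinaryForm.finrank_fixedBy_edge hn
    have key : 12 * (Module.finrank ℤ (H1GL2 n) : ℤ) =
        (n : ℤ) - 5 + 3 * (-1) ^ (n / 2 + 1) - 4 * eta n := by
      rw [pow_succ]
      zify at h
      linarith
    rw [eq_div_iff (by norm_num), mul_comm]
    exact_mod_cast key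
  refine ⟨groupCohomology.finite_H1_of_closure
    (BinaryGL.finite_squareGroup.union BinaryGL.finite_hexagonGroup)
    BinaryGL.closure_square_hexagon, hrank, ?_⟩
  have heta : (eta n : ℚ) ≤ 1 := by
    have : eta n ≤ 1 := by
      unfold eta
      split_ifs <;> norm_num
    exact_mod_cast this
  have hsign : (-1 : ℚ) ≤ (-1) ^ (n / 2 + 1) := by
    rcases neg_one_pow_eq_or ℚ (n / 2 + 1) with h | h <;> rw [h]
    norm_num
  rw [hrank]
  linarith
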